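/- **Setting.** Let $X(t)$ be a real-valued Markov process, given by its conditional laws $P_{s,x}$ (the law given $X(s)=x$). Fix $x_0,t_0$, and suppose that for $t>t_0$ the law of $X(t)$ under $P_{t_0,x_0}$ has a density $p(x,t)=p(x,t\mid x_0,t_0)$. Let $$\delta Z(k,\delta t\mid x,t)=E\big[e^{ik(X(t+\delta t)-x)}\,\big|\,X(t)=x\big]=\exp\big(\delta K(k,\delta t\mid x,t)\big)$$ define the cumulant generating function $\delta K$ of the increments: for all $k$ and $t>t_0$ this holds for all small $\delta t>0$ and $p(\cdot,t)$-almost every $x$. Let $J\subseteq[0,\infty)$ be countable. For $n\in J$ write $n!=\Gamma(n+1)$, $(-1)^n=e^{i\pi n}$, and let $(ik)^n$ denote a determination $|k|^n e^{i\theta_n\operatorname{sgn}k}$ with a fixed real phase $\theta_n$ ($\theta_n=n\pi/2$ is the principal value, and is the one used if $J\subseteq\mathbb N$; $\theta_n=0$ is Riesz's choice). Let the real functions $C_n(x,t)$, $n\in J$, be the cumulant rates of the increments, $$\delta K(k,\delta t\mid x,t)=\delta t\sum_{n\in J}\frac{(ik)^n}{n!}\,C_n(x,t)+o(\delta t),\qquad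 \delta t\to0^+,$$ where $o(\delta t)$ is understood for each fixed $k$ and $t>t_0$ in mean over $x$: the integral of the absolute value of the remainder against $p(x,t)\,dx$ is $o(\delta t)$. Assume that * $C_n(\cdot,t)p(\cdot,t)\in L^1(\mathbb R)$ for all $n\in J$, $t>t_0$; * for every $[a,b]\subset(t_0,\infty)$ there are $B_n$ with $\int|C_n(x,t)|\,p(x,t)\,dx\le B_n$ for $t\in[a,b]$, $n\in J$, and $\sum_{n\in J}R^nB_n/n!<\infty$ for all $R>0$; * $t\mapsto\int f\,p(x,t)\,dx$ and $t\mapsto\int f\,C_n(x,t)p(x,t)\,dx$ ($n\in J$) are continuous on $(t_0,\infty)$ for every bounded continuous $f(x)$. Put $$A_n(x,t)=\frac{(-1)^n}{n!}\,C_n(x,t),\qquad n\in J.$$ **Claim.** For $t>t_0$, $$\frac{\partial p}{\partial t}(x,t\mid x_0,t_0)=\sum_{n\in J}\frac{\partial^n}{\partial x^n}\big[A_n(x,t)\,p(x,t\mid x_0,t_0)\big] \tag{$*$}$$ in the following sense. 1. *Integer orders, $J\subseteq\mathbb N$.* $(*)$ holds in the sense of distributions in $x$: for every $t>t_0$ the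 products $A_n(\cdot,t)p(\cdot,t)$ are integrable, and for every test function $\varphi$ the function $t\mapsto\int\varphi\,p\,dx$ is differentiable with derivative $\sum_{n\in J}\int(-1)^n\varphi^{(n)}A_np\,dx$, the series being absolutely convergent. Test functions are all Schwartz functions if $J$ is finite, and the Schwartz functions with compactly supported Fourier transform if $J$ is infinite. If moreover $J$ is finite, $p$ is differentiable in $t$ with $\partial p/\partial t$ continuous on $\mathbb R\times(t_0,\infty)$, and $A_n(\cdot,t)p(\cdot,t)\in C^n(\mathbb R)$ for $n\in J$, $t>t_0$, then $(*)$ holds at every $x\in\mathbb R$ and $t>t_0$. 2. *Real orders, $J\subseteq[0,\infty)$.* With $F[f](k)=\int e^{ikx}f(x)\,dx$, let $\partial^n/\partial x^n$ be the fractional derivative $f\mapsto F^{-1}[m_nF[f]]$ with the determination $m_n(k)=(ik)^n/(-1)^n$ of $(-ik)^n$. Then $(*)$ holds in the same distributional sense, with the same test functions and with $(-1)^n\varphi^{(n)}$ replaced by the transposed fractional derivative $F^{-1}[m_n(-k)F[\varphi](k)]$. -/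

import Mathlib

open MeasureTheory ProbabilityTheory Filter Topology Set
open scoped SchwartzMap BoundedContinuousFunction

noncomputable section

namespace KramersMoyal

/-- The σ-algebra generated by the process `X` on the time interval `[s, t]`. -/
abbrev past {Ω : Type*} (X : ℝ → Ω → ℝ) (s t : ℝ) : MeasurableSpace Ω :=
  ⨆ r ∈ Icc s t, MeasurableSpace.comap (X r) inferInstance

/-- A real-valued (not necessarily time-homogeneous) Markov process `X(t)`: `P s x` is the
conditional law of the process given `X(s) = x`. -/
structure MarkovProcess (Ω : Type*) [MeasurableSpace Ω] where
  X : ℝ → Ω → ℝ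
  P : ℝ → ℝ → Measure Ω
  isProbabilityMeasure : ∀ s x, IsProbabilityMeasure (P s x)
  measurable_X : ∀ t, Measurable (X t)
  measurable_P : ∀ s t, s ≤ t → ∀ A : Set ℝ, MeasurableSet A →
    Measurable fun x => P s x (X t ⁻¹' A)
  start : ∀ s x, ∀ᵐ ω ∂(P s x), X s ω = x
  markov : ∀ s x t u, s ≤ t → t ≤ u → ∀ A : Set ℝ, MeasurableSet A →
    (P s x)⟦X u ⁻¹' A | past X s t⟧ =ᵐ[P s x] fun ω => (P t (X t ω)).real (X u ⁻¹' A)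

namespace MarkovProcess

variable {Ω : Type*} [MeasurableSpace Ω] (M : MarkovProcess Ω)

/-- The law of `X(t)` given `X(t₀) = x₀`. -/
def law (x₀ t₀ t : ℝ) : Measure ℝ := (M.P t₀ x₀).map (M.X t)

/-- `p x t` is the transition probability density `p(x, t | x₀, t₀)`, for `t > t₀`. -/
def IsTransitionDensity (x₀ t₀ : ℝ) (p : ℝ → ℝ → ℝ) : Prop :=
  ∀ t, t₀ < t → (∀ x, 0 ≤ p x t) ∧ Measurable (fun x => p x t) ∧
    M.law x₀ t₀ t = volume.withDensity fun x => ENNReal.ofReal (p x t)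

/-- First characteristic function of the increments:
`δZ(k, δ | x, t) = E[exp(i k (X(t + δ) - x)) | X(t) = x]`. -/
def incrementCharFun (k δ x t : ℝ) : ℂ :=
  ∫ ω, Complex.exp (Complex.I * k * (M.X (t + δ) ω - x)) ∂(M.P t x)

/-- For the process started from `x₀` at time `t₀`, the cumulant generating function
`K k δ x t` of the increments (a logarithm of their characteristic function) has the small-time
expansion `K = δ ∑ᵢ sᵢ(k) Cᵢ(x, t) / Γ(νᵢ + 1) + o(δ)`, where `sᵢ(k)` is a (determination of a)
power `(i k)^νᵢ`. The term `o(δ)` is meant for fixed `k` and `t`, in mean over the position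
`x = X(t)`. -/
structure HasCumulantExpansion (x₀ t₀ : ℝ) (K : ℝ → ℝ → ℝ → ℝ → ℂ)
    {ι : Type} (ν : ι → ℝ) (s : ι → ℝ → ℂ) (C : ι → ℝ → ℝ → ℝ) : Prop where
  exp_eq : ∀ k t, t₀ < t → ∀ᶠ δ in 𝓝[>] (0 : ℝ), ∀ᵐ x ∂(M.law x₀ t₀ t),
    Complex.exp (K k δ x t) = M.incrementCharFun k δ x t
  remainder : ∀ k t, t₀ < t → Tendsto
    (fun δ : ℝ => (∫⁻ x, ‖K k δ x t -
        δ * ∑' i, s i k / Real.Gamma (ν i + 1) * C i x t‖ₑ ∂(M.law x₀ t₀ t)) / ENNReal.ofReal δ)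
    (𝓝[>] 0) (𝓝 0)

end MarkovProcess

/-- The standing regularity: the products `Cᵢ p` are integrable, the sum
`∑ᵢ Rᵛ Cᵢ p / Γ(ν + 1)`, `ν = νᵢ`, converges normally in `L¹`, locally uniformly in time, and `p`
and the products `Cᵢ p` depend on time continuously for the narrow topology (that is, when tested
against bounded continuous functions of `x`). -/
structure IsAdmissible (t₀ : ℝ) (p : ℝ → ℝ → ℝ) {ι : Type} (ν : ι → ℝ)
    (C : ι → ℝ → ℝ → ℝ) : Prop where
  integrable : ∀ i t, t₀ < t → Integrable fun x => C i x t * p x t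
  normal : ∀ a b, t₀ < a → ∃ B : ι → ℝ,
    (∀ i, ∀ t ∈ Icc a b, ∫ x, |C i x t| * p x t ≤ B i) ∧
    ∀ R : ℝ, 0 < R → Summable fun i => R ^ ν i / Real.Gamma (ν i + 1) * B i
  continuous_p : ∀ f : ℝ →ᵇ ℝ, ContinuousOn (fun t => ∫ x, f x * p x t) (Ioi t₀)
  continuous_C : ∀ i, ∀ f : ℝ →ᵇ ℝ,
    ContinuousOn (fun t => ∫ x, f x * (C i x t * p x t)) (Ioi t₀)

/-- `F[f](k) = ∫ exp(i k x) f(x) dx`. -/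
def fourier (f : ℝ → ℂ) (k : ℝ) : ℂ := ∫ x : ℝ, Complex.exp (Complex.I * k * x) * f x

/-- `F⁻¹[g](x) = (2π)⁻¹ ∫ exp(-i k x) g(k) dk`. -/
def invFourier (g : ℝ → ℂ) (x : ℝ) : ℂ :=
  1 / (2 * Real.pi) * ∫ k : ℝ, Complex.exp (-(Complex.I * k * x)) * g k

/-- The operator `f ↦ F⁻¹[m F[f]]`. -/
def fourierMultiplier (m : ℝ → ℂ) (f : ℝ → ℂ) : ℝ → ℂ :=
  invFourier fun k => m k * fourier f k

/-- The determination `|k|ⁿ exp(i θ sgn k)` of the power `(i k)ⁿ`. The phase `θ = n π / 2` gives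
the principal value of `(i k)ⁿ`, see `fracPow_principal`, and `θ = 0` gives Riesz's `|k|ⁿ`. -/
def fracPow (θ n k : ℝ) : ℂ := ((|k| ^ n : ℝ) : ℂ) * Complex.exp (Complex.I * θ * SignType.sign k)

theorem fracPow_principal (n k : ℝ) :
    fracPow (n * Real.pi / 2) n k = (Complex.I * k) ^ (n : ℂ) := by
  unfold fracPow
  rcases lt_trichotomy k 0 with h | h | h
  · have e : Complex.I * (k : ℂ) = ((-k : ℝ) : ℂ) * (-Complex.I) := by push_cast; ring
    have hk : 0 < -k := by linarith
    rw [e, Complex.cpow_def_of_ne_zero (by simp [h.ne]), Complex.log_ofReal_mul hk (by simp),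
      Complex.log_neg_I, abs_of_neg h, Real.rpow_def_of_pos hk, sign_neg h, Complex.ofReal_exp,
      ← Complex.exp_add]
    congr 1
    simp only [SignType.coe_neg_one]
    push_cast
    ring
  · subst h
    by_cases hn : n = 0 <;> simp [hn]
  · have e : Complex.I * (k : ℂ) = (k : ℂ) * Complex.I := by ring
    rw [e, Complex.cpow_def_of_ne_zero (by simp [h.ne']), Complex.log_ofReal_mul h (by simp),
      Complex.log_I, abs_of_pos h, Real.rpow_def_of_pos h, sign_pos h, Complex.ofReal_exp,
      ← Complex.exp_add]
    congr 1
    simp only [SignType.coe_one]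
    push_cast
    ring

/-- The multiplier of the derivative `∂ⁿ/∂xⁿ` of real order `n`, that is, the determination
`(i k)ⁿ / (-1)ⁿ` of `(-i k)ⁿ`. -/
def fracDerivSymbol (θ n k : ℝ) : ℂ := fracPow θ n k / (-1 : ℂ) ^ (n : ℂ)

/-- The transpose of `∂ⁿ/∂xⁿ`, `n` real: `∫ (∂ⁿ f) φ = ∫ f (∂ⁿ)ᵀ φ`. The transpose of
`f ↦ F⁻¹[m(k) F[f]]` is `φ ↦ F⁻¹[m(-k) F[φ]]`. -/
def fracDerivTranspose (θ n : ℝ) (φ : ℝ → ℂ) : ℝ → ℂ :=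
  fourierMultiplier (fun k => fracDerivSymbol θ n (-k)) φ

/-- Test functions for a sum of derivatives with orders in `J`: all Schwartz functions if `J` is
finite; if `J` is infinite, those with a compactly supported Fourier transform (on which series
of derivatives converge). -/
def IsTest {α : Type} (J : Set α) (φ : 𝓢(ℝ, ℂ)) : Prop :=
  J.Finite ∨ HasCompactSupport (fourier φ)

/-- `∂p/∂t = ∑_{n ∈ J} ∂ⁿ/∂xⁿ [A_n(x,t) p(x,t)]` for `t > t₀`, in the sense of distributions in
`x`, for natural orders `n`. -/
def IsWeakSolution (t₀ : ℝ) (J : Set ℕ) (A : ℕ → ℝ → ℝ → ℝ) (p : ℝ → ℝ → ℝ) : Prop :=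
  ∀ t, t₀ < t →
    (∀ n ∈ J, Integrable fun x => A n x t * p x t) ∧
    ∀ φ : 𝓢(ℝ, ℂ), IsTest J φ →
      (Summable fun n : J => ∫ x, (-1) ^ (n : ℕ) * iteratedDeriv n φ x * ((A n x t * p x t : ℝ) : ℂ)) ∧
      HasDerivAt (fun τ => ∫ x, φ x * (p x τ : ℂ))
        (∑' n : J, ∫ x, (-1) ^ (n : ℕ) * iteratedDeriv n φ x * ((A n x t * p x t : ℝ) : ℂ)) t

/-- `∂p/∂t = ∑_{n ∈ J} ∂ⁿ/∂xⁿ [A_n(x,t) p(x,t)]` for `t > t₀`, in the sense of distributions in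
`x`, for real orders `n`, the derivative of order `n` being taken with the phase `θ n`. -/
def IsFracWeakSolution (t₀ : ℝ) (J : Set ℝ) (θ : ℝ → ℝ) (A : ℝ → ℝ → ℝ → ℂ)
    (p : ℝ → ℝ → ℝ) : Prop :=
  ∀ t, t₀ < t →
    (∀ n ∈ J, Integrable fun x => A n x t * (p x t : ℂ)) ∧
    ∀ φ : 𝓢(ℝ, ℂ), IsTest J φ →
      (Summable fun n : J => ∫ x, fracDerivTranspose (θ n) n φ x * (A n x t * (p x t : ℂ))) ∧
      HasDerivAt (fun τ => ∫ x, φ x * (p x τ : ℂ))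
        (∑' n : J, ∫ x, fracDerivTranspose (θ n) n φ x * (A n x t * (p x t : ℂ))) t

/-- The regularity that a classical solution requires: `∂p/∂t` exists and is continuous in
`(x, t)`, and `A_n p` has `n` continuous derivatives in `x`. -/
def IsClassical (t₀ : ℝ) (J : Set ℕ) (A : ℕ → ℝ → ℝ → ℝ) (p : ℝ → ℝ → ℝ) : Prop :=
  (∀ x t, t₀ < t → DifferentiableAt ℝ (fun τ => p x τ) t) ∧
  ContinuousOn (fun z : ℝ × ℝ => deriv (fun τ => p z.1 τ) z.2) (univ ×ˢ Ioi t₀) ∧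
  ∀ n ∈ J, ∀ t, t₀ < t → ContDiff ℝ n fun x => A n x t * p x t

end KramersMoyal

end

noncomputable section

namespace KramersMoyal

/-! The equation is an ordinary differential equation in time for each Fourier mode, tested
afterwards against `φ`. Let χ(t) be the characteristic function of X(t) at frequency k.
Chapman–Kolmogorov (`law_eq_bind`) gives χ(t+δ) = E[e^{ikX(t)} δZ], so the difference quotient of χ
is E[e^{ikX(t)} (δZ − 1)/δ], with δZ = exp K and K = δS + o(δ) in L¹, where S = Σ (ik)ⁿ Cₙ/n!.

The difficulty is to exponentiate an L¹ estimate when S is unbounded. Since |δZ| ≤ 1, Re K ≤ 0;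
letting δ → 0, also Re S ≤ 0 almost everywhere (`re_nonpos_of_cumulant`). On the left half-plane exp
is 1-Lipschitz, so δZ − e^{δS} is o(δ) in L¹, while (e^{δS} − 1)/δ → S is dominated by |S|
(`tendsto_integral_of_cumulant`). Hence χ has the right derivative E[e^{ikX} S] = `charRate`. Narrow
continuity makes χ and `charRate` continuous in time, which upgrades the right derivative to a
derivative (`hasDerivAt_fourier_density`).

Parseval's formula and differentiation under the k-integral then give `weak_kramersMoyal`. It asks
of the symbols only measurability and |sᵢ(k)| ≤ |k|^νᵢ, so integer and fractional orders, with any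
phase, are treated together. For finite `J`, regularity, integration by parts and localisation turn
the weak equation into a pointwise one. -/

theorem norm_exp_I_mul_mul (k x : ℝ) : ‖Complex.exp (Complex.I * k * x)‖ = 1 := by
  rw [mul_assoc, ← Complex.ofReal_mul, mul_comm, Complex.norm_exp_ofReal_mul_I]

theorem past_le {Ω : Type*} [m : MeasurableSpace Ω] {X : ℝ → Ω → ℝ} (hX : ∀ t, Measurable (X t))
    (s t : ℝ) : past X s t ≤ m :=
  iSup₂_le fun r _ => (hX r).comap_le

/-! ### Chapman–Kolmogorov and characteristic functions -/

namespace MarkovProcess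

variable {Ω : Type*} [MeasurableSpace Ω] (M : MarkovProcess Ω)

instance isProbabilityMeasure_law (x₀ t₀ t : ℝ) : IsProbabilityMeasure (M.law x₀ t₀ t) :=
  have := M.isProbabilityMeasure t₀ x₀
  Measure.isProbabilityMeasure_map (M.measurable_X t).aemeasurable

/-- The transition kernel of the process between the times `s ≤ t`. -/
def transition {s t : ℝ} (hst : s ≤ t) : Kernel ℝ ℝ where
  toFun x := M.law x s t
  measurable' := by
    refine Measure.measurable_of_measurable_coe _ fun A hA => ?_
    simpa only [law, Measure.map_apply (M.measurable_X t) hA] using M.measurable_P s t hst A hA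

theorem transition_apply {s t : ℝ} (hst : s ≤ t) (x : ℝ) :
    M.transition hst x = M.law x s t := rfl

instance {s t : ℝ} (hst : s ≤ t) : IsMarkovKernel (M.transition hst) :=
  ⟨fun x => inferInstanceAs (IsProbabilityMeasure (M.law x s t))⟩

/-- The Chapman–Kolmogorov equation. -/
theorem law_eq_bind (x₀ : ℝ) {t₀ t u : ℝ} (h₀ : t₀ ≤ t) (htu : t ≤ u) :
    M.law x₀ t₀ u = (M.law x₀ t₀ t).bind (M.transition htu) := by
  have hP := M.isProbabilityMeasure t₀ x₀
  ext A hA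
  have hXA : MeasurableSet (M.X u ⁻¹' A) := M.measurable_X u hA
  have hm := past_le M.measurable_X t₀ t
  -- Taking expectations in the Markov property removes the conditioning.
  have h1 : ∫ ω, (M.P t (M.X t ω)).real (M.X u ⁻¹' A) ∂(M.P t₀ x₀)
      = (M.P t₀ x₀).real (M.X u ⁻¹' A) := by
    rw [← integral_congr_ae (M.markov t₀ x₀ t u h₀ htu A hA), integral_condExp hm,
      integral_indicator hXA]
    simp [measureReal_def]
  have hmeas : Measurable fun ω => M.P t (M.X t ω) (M.X u ⁻¹' A) :=
    (M.measurable_P t u htu A hA).comp (M.measurable_X t)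
  rw [Measure.bind_apply hA (Kernel.aemeasurable _), law, law,
    Measure.map_apply (M.measurable_X u) hA,
    lintegral_map ((M.transition htu).measurable_coe hA) (M.measurable_X t)]
  simp only [transition_apply, law, Measure.map_apply (M.measurable_X u) hA]
  have h2 : ∀ ω, M.P t (M.X t ω) (M.X u ⁻¹' A)
      = ENNReal.ofReal ((M.P t (M.X t ω)).real (M.X u ⁻¹' A)) := fun ω => by
    have := M.isProbabilityMeasure t (M.X t ω)
    simp
  simp_rw [h2]
  rw [← ofReal_integral_eq_lintegral_ofReal ?_ (.of_forall fun _ => measureReal_nonneg), h1]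
  · simp
  · refine Integrable.of_bound (C := 1) (hmeas.ennreal_toReal.aestronglyMeasurable)
      (.of_forall fun ω => ?_)
    have := M.isProbabilityMeasure t (M.X t ω)
    rw [Real.norm_of_nonneg measureReal_nonneg]
    exact measureReal_le_one

/-- The factor e^{ikx} undoes the centring at x, which turns increments into positions governed by
the transition kernel. -/
theorem exp_mul_incrementCharFun (k δ x t : ℝ) :
    Complex.exp (Complex.I * k * x) * M.incrementCharFun k δ x t
      = ∫ y : ℝ, Complex.exp (Complex.I * k * y) ∂(M.law x t (t + δ)) := by
  rw [incrementCharFun, law, integral_map (M.measurable_X _).aemeasurable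
    (by fun_prop), ← integral_const_mul]
  congr 1 with ω
  rw [← Complex.exp_add]
  congr 1
  ring

theorem norm_incrementCharFun_le (k δ x t : ℝ) : ‖M.incrementCharFun k δ x t‖ ≤ 1 := by
  have := M.isProbabilityMeasure t x
  refine (norm_integral_le_integral_norm _).trans (le_of_eq ?_)
  have h : ∀ ω, ‖Complex.exp (Complex.I * k * (M.X (t + δ) ω - x))‖ = 1 := fun ω => by
    rw [← Complex.ofReal_sub, norm_exp_I_mul_mul]
  simp [h]

/-- `measurable_P` controls one-time events only, so measurability in x is obtained by writing the
integral against the transition kernel. -/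
theorem measurable_incrementCharFun (k t : ℝ) {δ : ℝ} (hδ : 0 ≤ δ) :
    Measurable fun x => M.incrementCharFun k δ x t := by
  have h : Measurable fun x : ℝ => ∫ y : ℝ, Complex.exp (Complex.I * k * y)
      ∂(M.transition (le_add_of_nonneg_right hδ : t ≤ t + δ) x) :=
    (StronglyMeasurable.integral_kernel (by fun_prop)).measurable
  have e : (fun x => M.incrementCharFun k δ x t) = fun x : ℝ =>
      Complex.exp (-(Complex.I * k * x)) * ∫ y : ℝ, Complex.exp (Complex.I * k * y)
      ∂(M.transition (le_add_of_nonneg_right hδ : t ≤ t + δ) x) := by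
    ext x
    rw [transition_apply, ← exp_mul_incrementCharFun, ← mul_assoc, ← Complex.exp_add]
    simp
  rw [e]
  exact Measurable.mul (by fun_prop) h

/-- Evolution of the characteristic function of the process. -/
theorem integral_exp_law_add (k x₀ : ℝ) {t₀ t δ : ℝ} (h₀ : t₀ ≤ t) (hδ : 0 ≤ δ) :
    ∫ x : ℝ, Complex.exp (Complex.I * k * x) ∂(M.law x₀ t₀ (t + δ))
      = ∫ x : ℝ, Complex.exp (Complex.I * k * x) * M.incrementCharFun k δ x t
        ∂(M.law x₀ t₀ t) := by
  simp_rw [exp_mul_incrementCharFun]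
  rw [M.law_eq_bind x₀ h₀ (le_add_of_nonneg_right hδ : t ≤ t + δ)]
  have h := Kernel.integral_comp (κ := Kernel.const Unit (M.law x₀ t₀ t))
    (η := M.transition (le_add_of_nonneg_right hδ : t ≤ t + δ)) (a := ())
    (f := fun x : ℝ => Complex.exp (Complex.I * k * x)) ?_
  · rwa [Kernel.comp_apply, Kernel.const_apply] at h
  · refine Integrable.of_bound (C := 1) (by fun_prop) (.of_forall fun x => ?_)
    rw [norm_exp_I_mul_mul]

end MarkovProcess

/-! ### Small-time limit: from cumulants to the characteristic function -/

theorem integrable_tsum_of_summable_integral_norm {α ι 𝕜 : Type*} [MeasurableSpace α]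
    [Countable ι] [RCLike 𝕜] {μ : Measure α} {F : ι → α → 𝕜} (hF : ∀ i, Integrable (F i) μ)
    (hs : Summable fun i => ∫ a, ‖F i a‖ ∂μ) : Integrable (fun a => ∑' i, F i a) μ := by
  refine ⟨(AEMeasurable.tsum fun i => (hF i).aemeasurable).aestronglyMeasurable, ?_⟩
  rw [hasFiniteIntegral_iff_enorm]
  calc ∫⁻ a, ‖∑' i, F i a‖ₑ ∂μ ≤ ∫⁻ a, ∑' i, ‖F i a‖ₑ ∂μ :=
        lintegral_mono fun a => enorm_tsum_le_tsum_enorm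
    _ = ∑' i, ∫⁻ a, ‖F i a‖ₑ ∂μ := lintegral_tsum fun i => (hF i).aemeasurable.enorm
    _ = ∑' i, ENNReal.ofReal (∫ a, ‖F i a‖ ∂μ) := by
        congr 1 with i
        exact (ofReal_integral_norm_eq_lintegral_enorm (hF i)).symm
    _ < ⊤ := by
        rw [← ENNReal.ofReal_tsum_of_nonneg (fun i => by positivity) hs]
        exact ENNReal.ofReal_lt_top

/-- Mean value inequality on a convex half-plane where |exp′| = e^{Re} ≤ 1. It carries L¹ bounds
from exponents to exponentials without any bound on the exponents. -/
theorem norm_exp_sub_exp_le_of_re_nonpos {z w : ℂ} (hz : z.re ≤ 0) (hw : w.re ≤ 0) :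
    ‖Complex.exp z - Complex.exp w‖ ≤ ‖z - w‖ := by
  have h := Convex.norm_image_sub_le_of_norm_deriv_le (f := Complex.exp) (C := 1)
    (s := {z : ℂ | z.re ≤ 0}) (fun x _ => Complex.differentiableAt_exp) (fun x hx => by
      rw [Complex.deriv_exp, Complex.norm_exp]
      exact Real.exp_le_one_iff.2 hx) (convex_halfSpace_re_le 0) hw hz
  simpa using h

section SmallTime

variable {α : Type*} [MeasurableSpace α] {μ : Measure α} {S : α → ℂ} {Z K : ℝ → α → ℂ}

/-- The first-order coefficient of the cumulant generating function of a family of laws has a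
nonpositive real part. -/
theorem re_nonpos_of_cumulant (hS : AEMeasurable S μ) (hZ : ∀ δ x, ‖Z δ x‖ ≤ 1)
    (hexp : ∀ᶠ δ in 𝓝[>] (0 : ℝ), ∀ᵐ x ∂μ, Complex.exp (K δ x) = Z δ x)
    (hrem : Tendsto (fun δ : ℝ => (∫⁻ x, ‖K δ x - δ * S x‖ₑ ∂μ) / ENNReal.ofReal δ)
      (𝓝[>] 0) (𝓝 0)) : ∀ᵐ x ∂μ, (S x).re ≤ 0 := by
  -- As Re K ≤ 0, the positive part of δ Re S is at most |K − δS|; after division by δ its integral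
  -- is bounded by a quantity tending to 0. The comparison is pointwise, so `K` need not be
  -- measurable.
  have h0 : ∫⁻ x, ENNReal.ofReal (S x).re ∂μ ≤ 0 := by
    refine ge_of_tendsto hrem ?_
    filter_upwards [hexp, self_mem_nhdsWithin] with δ hδ hpos
    have hpos : 0 < δ := hpos
    rw [ENNReal.le_div_iff_mul_le (.inl (by simpa using hpos)) (.inl ENNReal.ofReal_ne_top),
      ← lintegral_mul_const' _ _ ENNReal.ofReal_ne_top]
    refine lintegral_mono_ae ?_
    filter_upwards [hδ] with x hx
    have hK : (K δ x).re ≤ 0 := by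
      have := hZ δ x
      rwa [← hx, Complex.norm_exp, Real.exp_le_one_iff] at this
    rw [← ENNReal.ofReal_mul' hpos.le, ← ofReal_norm]
    refine ENNReal.ofReal_le_ofReal ?_
    have h1 := (abs_le.1 (Complex.abs_re_le_norm (K δ x - δ * S x))).1
    rw [Complex.sub_re, Complex.re_ofReal_mul] at h1
    linarith
  have h1 := (lintegral_eq_zero_iff' hS.re.ennreal_ofReal).1 (le_antisymm h0 bot_le)
  filter_upwards [h1] with x hx
  simpa using hx

/-- Split Z − 1 = (Z − e^{δS}) + (e^{δS} − 1): the first part is controlled by the cumulant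
remainder, the second by dominated convergence with majorant |S|. -/
theorem tendsto_integral_of_cumulant [IsFiniteMeasure μ] (hS : Integrable S μ)
    (hZm : ∀ δ, 0 < δ → AEStronglyMeasurable (Z δ) μ) (hZ : ∀ δ x, ‖Z δ x‖ ≤ 1)
    (hexp : ∀ᶠ δ in 𝓝[>] (0 : ℝ), ∀ᵐ x ∂μ, Complex.exp (K δ x) = Z δ x)
    (hrem : Tendsto (fun δ : ℝ => (∫⁻ x, ‖K δ x - δ * S x‖ₑ ∂μ) / ENNReal.ofReal δ)
      (𝓝[>] 0) (𝓝 0))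
    {e : α → ℂ} (hem : AEStronglyMeasurable e μ) (he : ∀ x, ‖e x‖ = 1) :
    Tendsto (fun δ : ℝ => δ⁻¹ • ∫ x, e x * (Z δ x - 1) ∂μ) (𝓝[>] 0)
      (𝓝 (∫ x, e x * S x ∂μ)) := by
  have hre := re_nonpos_of_cumulant hS.aemeasurable hZ hexp hrem
  have hSm : ∀ δ : ℝ, AEStronglyMeasurable (fun x => Complex.exp (δ * S x)) μ := fun δ =>
    Complex.continuous_exp.comp_aestronglyMeasurable (hS.aestronglyMeasurable.const_mul _)
  have hre' : ∀ δ : ℝ, 0 < δ → ∀ᵐ x ∂μ, ((δ : ℂ) * S x).re ≤ 0 := fun δ hδ => by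
    filter_upwards [hre] with x hx
    rw [Complex.re_ofReal_mul]
    exact mul_nonpos_of_nonneg_of_nonpos hδ.le hx
  have hA : Tendsto (fun δ : ℝ => δ⁻¹ • ∫ x, e x * (Z δ x - Complex.exp (δ * S x)) ∂μ) (𝓝[>] 0)
      (𝓝 0) := by
    rw [tendsto_zero_iff_norm_tendsto_zero]
    have hrem' : Tendsto (fun δ : ℝ => ((∫⁻ x, ‖K δ x - δ * S x‖ₑ ∂μ) / ENNReal.ofReal δ).toReal)
        (𝓝[>] 0) (𝓝 0) :=
      (ENNReal.tendsto_toReal ENNReal.zero_ne_top).comp hrem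
    refine squeeze_zero' (.of_forall fun _ => norm_nonneg _) ?_ hrem'
    filter_upwards [hexp, self_mem_nhdsWithin, hrem.eventually_lt_const ENNReal.zero_lt_top]
      with δ hδ hpos htop
    have hpos : 0 < δ := hpos
    refine (ENNReal.ofReal_le_iff_le_toReal htop.ne).1 ?_
    rw [norm_smul, ENNReal.ofReal_mul (norm_nonneg _), mul_comm, ofReal_norm,
      Real.norm_of_nonneg (inv_nonneg.2 hpos.le), ENNReal.ofReal_inv_of_pos hpos, div_eq_mul_inv]
    gcongr
    refine (enorm_integral_le_lintegral_enorm _).trans (lintegral_mono_ae ?_)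
    filter_upwards [hδ, hre' δ hpos] with x hx hr
    rw [← ofReal_norm, ← ofReal_norm, norm_mul, he, one_mul, ← hx]
    refine ENNReal.ofReal_le_ofReal (norm_exp_sub_exp_le_of_re_nonpos ?_ hr)
    have := hZ δ x
    rwa [← hx, Complex.norm_exp, Real.exp_le_one_iff] at this
  have hB : Tendsto (fun δ : ℝ => ∫ x, e x * (δ⁻¹ • (Complex.exp (δ * S x) - 1)) ∂μ) (𝓝[>] 0)
      (𝓝 (∫ x, e x * S x ∂μ)) := by
    refine tendsto_integral_filter_of_dominated_convergence (fun x => ‖S x‖) ?_ ?_ hS.norm ?_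
    · exact .of_forall fun δ => hem.mul
        (((hSm δ).sub (aestronglyMeasurable_const (b := 1))).const_smul δ⁻¹)
    · filter_upwards [self_mem_nhdsWithin] with δ hpos
      have hpos : 0 < δ := hpos
      filter_upwards [hre' δ hpos] with x hx
      rw [norm_mul, he, one_mul, norm_smul, Real.norm_of_nonneg (inv_nonneg.2 hpos.le),
        inv_mul_le_iff₀ hpos]
      have := norm_exp_sub_exp_le_of_re_nonpos hx (w := 0) le_rfl
      simpa [abs_of_pos hpos] using this
    · refine .of_forall fun x => Tendsto.const_mul _ ?_
      have h1 : HasDerivAt (fun δ : ℝ => Complex.exp (δ * S x)) (S x) 0 := by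
        have h2 : HasDerivAt (fun δ : ℝ => (δ : ℂ) * S x) (1 * S x) 0 :=
          (Complex.ofRealCLM.hasDerivAt (x := (0 : ℝ))).mul_const (S x)
        simpa using h2.cexp
      simpa using h1.tendsto_slope_zero_right
  have hAB := hA.add hB
  rw [zero_add] at hAB
  refine hAB.congr' ?_
  filter_upwards [self_mem_nhdsWithin] with δ hpos
  have hpos : 0 < δ := hpos
  have hb : ∀ f : α → ℂ, AEStronglyMeasurable f μ → (∀ᵐ x ∂μ, ‖f x‖ ≤ 1) →
      Integrable (fun x => e x * f x) μ := fun f hf hf1 =>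
    .of_bound (hem.mul hf) 1 (by filter_upwards [hf1] with x hx; rwa [norm_mul, he, one_mul])
  have hi1 := hb _ (hZm δ hpos) (.of_forall (hZ δ))
  have hi2 := hb _ (hSm δ) (by
    filter_upwards [hre' δ hpos] with x hx
    rwa [Complex.norm_exp, Real.exp_le_one_iff])
  have hi3 := hb 1 aestronglyMeasurable_const (by simp)
  simp only [Pi.one_apply] at hi3
  simp_rw [mul_smul_comm, integral_smul, mul_sub]
  rw [integral_sub hi1 hi2, integral_sub hi2 hi3, integral_sub hi1 hi3, ← smul_add]
  congr 1
  ring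

end SmallTime

/-! ### Right derivatives and Fourier transforms depending on time -/

theorem hasDerivAt_of_hasDerivWithinAt_Ioi {g D : ℝ → ℂ} {t₀ : ℝ} (hg : ContinuousOn g (Ioi t₀))
    (hD : ContinuousOn D (Ioi t₀))
    (h : ∀ t, t₀ < t → HasDerivWithinAt g (D t) (Ioi t) t) {t : ℝ} (ht : t₀ < t) :
    HasDerivAt g (D t) t := by
  obtain ⟨a, ha, hat⟩ := exists_between ht
  have hsub : ∀ τ, a < τ → uIcc a τ ⊆ Ioi t₀ := fun τ hτ x hx => by
    rw [uIcc_of_le hτ.le] at hx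
    exact ha.trans_le hx.1
  have hint : ∀ τ, a < τ → IntervalIntegrable D volume a τ := fun τ hτ =>
    (hD.mono (hsub τ hτ)).intervalIntegrable
  -- The fundamental theorem of calculus needs only right derivatives to identify `g` with this
  -- primitive, and continuity of `D` makes the primitive differentiable from both sides.
  have hI : HasDerivAt (fun τ => g a + ∫ y in a..τ, D y) (D t) t :=
    (intervalIntegral.integral_hasDerivAt_right (hint t hat)
      (hD.stronglyMeasurableAtFilter isOpen_Ioi t ht)
      (hD.continuousAt (Ioi_mem_nhds ht))).const_add (g a)
  refine hI.congr_of_eventuallyEq ?_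
  filter_upwards [Ioi_mem_nhds hat] with τ hτ
  rw [intervalIntegral.integral_eq_sub_of_hasDeriv_right (hg.mono (hsub τ hτ)) _ (hint τ hτ)]
  · ring
  · intro x hx
    rw [min_eq_left (le_of_lt hτ)] at hx
    exact h x (ha.trans hx.1)

theorem fourier_eq_cos_add_sin {f : ℝ → ℝ} (hf : Integrable f) (k : ℝ) :
    fourier (fun x => (f x : ℂ)) k
      = ((∫ x, Real.cos (k * x) * f x : ℝ) : ℂ)
        + Complex.I * ((∫ x, Real.sin (k * x) * f x : ℝ) : ℂ) := by
  have hc : Integrable fun x => Real.cos (k * x) * f x :=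
    hf.bdd_mul (c := 1) (by fun_prop) (.of_forall fun x => Real.abs_cos_le_one _)
  have hs : Integrable fun x => Real.sin (k * x) * f x :=
    hf.bdd_mul (c := 1) (by fun_prop) (.of_forall fun x => Real.abs_sin_le_one _)
  rw [fourier, ← integral_complex_ofReal, ← integral_complex_ofReal, ← integral_const_mul,
    ← integral_add hc.ofReal (hs.ofReal.const_mul _)]
  congr 1 with x
  have : Complex.I * (k : ℂ) * x = ((k * x : ℝ) : ℂ) * Complex.I := by push_cast; ring
  rw [this, Complex.exp_mul_I]
  push_cast
  ring

/-- Continuity of a Fourier transform with respect to a parameter, for the narrow topology. -/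
theorem continuousOn_fourier {q : ℝ → ℝ → ℝ} {T : Set ℝ} (hq : ∀ t ∈ T, Integrable fun x => q x t)
    (hc : ∀ f : ℝ →ᵇ ℝ, ContinuousOn (fun t => ∫ x, f x * q x t) T) (k : ℝ) :
    ContinuousOn (fun t => fourier (fun x => (q x t : ℂ)) k) T := by
  -- Narrow continuity is assumed for real test functions, so the character is tested through its
  -- cosine and sine.
  have h1 := hc (.ofNormedAddCommGroup (fun x => Real.cos (k * x)) (by fun_prop) 1
    fun x => Real.abs_cos_le_one _)
  have h2 := hc (.ofNormedAddCommGroup (fun x => Real.sin (k * x)) (by fun_prop) 1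
    fun x => Real.abs_sin_le_one _)
  refine ContinuousOn.congr ?_ fun t ht => fourier_eq_cos_add_sin (hq t ht) k
  exact (Complex.continuous_ofReal.comp_continuousOn h1).add
    (continuousOn_const.mul (Complex.continuous_ofReal.comp_continuousOn h2))

theorem norm_fourier_le (f : ℝ → ℂ) (k : ℝ) : ‖fourier f k‖ ≤ ∫ x, ‖f x‖ := by
  refine (norm_integral_le_integral_norm _).trans (le_of_eq ?_)
  congr 1 with x
  rw [norm_mul, norm_exp_I_mul_mul, one_mul]

theorem continuous_fourier {f : ℝ → ℂ} (hf : Integrable f) : Continuous (fourier f) := by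
  refine continuous_of_dominated (bound := fun x => ‖f x‖) (fun k => ?_) (fun k => ?_) hf.norm ?_
  · exact AEStronglyMeasurable.mul (by fun_prop) hf.aestronglyMeasurable
  · refine .of_forall fun x => ?_
    rw [norm_mul, norm_exp_I_mul_mul, one_mul]
  · exact .of_forall fun x => by fun_prop

/-- The time derivative of the characteristic function in terms of the cumulant rates. -/
def charRate {ι : Type} (p : ℝ → ℝ → ℝ) (ν : ι → ℝ) (s : ι → ℝ → ℂ) (C : ι → ℝ → ℝ → ℝ)
    (k t : ℝ) : ℂ :=
  ∑' i, s i k / Real.Gamma (ν i + 1) * fourier (fun x => ((C i x t * p x t : ℝ) : ℂ)) k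

/-! ### The evolution equation of the characteristic function -/

namespace MarkovProcess.IsTransitionDensity

variable {Ω : Type*} [MeasurableSpace Ω] {M : MarkovProcess Ω} {x₀ t₀ t : ℝ} {p : ℝ → ℝ → ℝ}

theorem integral_law (hp : M.IsTransitionDensity x₀ t₀ p) (ht : t₀ < t) (f : ℝ → ℂ) :
    ∫ x, f x ∂(M.law x₀ t₀ t) = ∫ x, f x * (p x t : ℂ) := by
  obtain ⟨h0, hm, he⟩ := hp t ht
  rw [he, integral_withDensity_eq_integral_toReal_smul hm.ennreal_ofReal
    (.of_forall fun _ => ENNReal.ofReal_lt_top)]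
  congr 1 with x
  rw [ENNReal.toReal_ofReal (h0 x), Complex.real_smul, mul_comm]

theorem integrable_law_iff (hp : M.IsTransitionDensity x₀ t₀ p) (ht : t₀ < t) {f : ℝ → ℂ} :
    Integrable f (M.law x₀ t₀ t) ↔ Integrable fun x => f x * (p x t : ℂ) := by
  obtain ⟨h0, hm, he⟩ := hp t ht
  rw [he, integrable_withDensity_iff_integrable_smul' hm.ennreal_ofReal
    (.of_forall fun _ => ENNReal.ofReal_lt_top)]
  refine integrable_congr (.of_forall fun x => ?_)
  simp only
  rw [ENNReal.toReal_ofReal (h0 x), Complex.real_smul, mul_comm]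

theorem integrable (hp : M.IsTransitionDensity x₀ t₀ p) (ht : t₀ < t) :
    Integrable fun x => p x t := by
  have h := (hp.integrable_law_iff ht).1 (integrable_const (1 : ℂ))
  simpa using h.re

theorem fourier_eq (hp : M.IsTransitionDensity x₀ t₀ p) (ht : t₀ < t) (k : ℝ) :
    fourier (fun x => (p x t : ℂ)) k
      = ∫ x : ℝ, Complex.exp (Complex.I * k * x) ∂(M.law x₀ t₀ t) :=
  (hp.integral_law ht _).symm

end MarkovProcess.IsTransitionDensity

section Evolution

variable {Ω : Type*} [MeasurableSpace Ω] {M : MarkovProcess Ω} {x₀ t₀ : ℝ} {p : ℝ → ℝ → ℝ}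
  {K : ℝ → ℝ → ℝ → ℝ → ℂ} {ι : Type} {ν : ι → ℝ} {s : ι → ℝ → ℂ} {C : ι → ℝ → ℝ → ℝ}

theorem norm_div_Gamma_le (hν : ∀ i, 0 ≤ ν i) (hs : ∀ i k, ‖s i k‖ ≤ |k| ^ ν i) (i : ι)
    {k R : ℝ} (hk : |k| ≤ R) :
    ‖s i k / (Real.Gamma (ν i + 1) : ℂ)‖ ≤ R ^ ν i / Real.Gamma (ν i + 1) := by
  have hΓ : 0 < Real.Gamma (ν i + 1) := Real.Gamma_pos_of_pos (by linarith [hν i])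
  rw [norm_div, Complex.norm_real, Real.norm_of_nonneg hΓ.le]
  gcongr
  exact (hs i k).trans (Real.rpow_le_rpow (abs_nonneg k) hk (hν i))

theorem integral_norm_flux (hp : M.IsTransitionDensity x₀ t₀ p) (i : ι) {t : ℝ} (ht : t₀ < t) :
    ∫ x, ‖((C i x t * p x t : ℝ) : ℂ)‖ = ∫ x, |C i x t| * p x t := by
  congr 1 with x
  rw [Complex.norm_real, Real.norm_eq_abs, abs_mul, abs_of_nonneg ((hp t ht).1 x)]

theorem norm_rate_term_le (hp : M.IsTransitionDensity x₀ t₀ p) (hν : ∀ i, 0 ≤ ν i)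
    (hs : ∀ i k, ‖s i k‖ ≤ |k| ^ ν i) {B : ι → ℝ} {T : Set ℝ} (hT : T ⊆ Ioi t₀)
    (hB : ∀ i, ∀ t ∈ T, ∫ x, |C i x t| * p x t ≤ B i) (i : ι) {k R t : ℝ} (hk : |k| ≤ R)
    (ht : t ∈ T) :
    ‖s i k / Real.Gamma (ν i + 1) * fourier (fun x => ((C i x t * p x t : ℝ) : ℂ)) k‖
      ≤ R ^ ν i / Real.Gamma (ν i + 1) * B i := by
  rw [norm_mul]
  have h1 := norm_div_Gamma_le hν hs i hk
  refine mul_le_mul h1 ?_ (norm_nonneg _) ((norm_nonneg _).trans h1)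
  refine (norm_fourier_le _ _).trans ?_
  rw [integral_norm_flux hp i (hT ht)]
  exact hB i t ht

theorem continuousOn_charRate (hp : M.IsTransitionDensity x₀ t₀ p) (hν : ∀ i, 0 ≤ ν i)
    (hs : ∀ i k, ‖s i k‖ ≤ |k| ^ ν i) (hadm : IsAdmissible t₀ p ν C) (k : ℝ) :
    ContinuousOn (charRate p ν s C k) (Ioi t₀) := by
  intro t ht
  obtain ⟨a, ha, hat⟩ := exists_between (show t₀ < t from ht)
  obtain ⟨B, hB, hsum⟩ := hadm.normal a (t + 1) ha
  have hsub : Icc a (t + 1) ⊆ Ioi t₀ := fun x hx => ha.trans_le hx.1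
  have hc : ContinuousOn (charRate p ν s C k) (Icc a (t + 1)) := by
    -- The radius |k| + 1 is used because the summability hypothesis requires R > 0, which |k|
    -- violates at k = 0.
    refine continuousOn_tsum (fun i => continuousOn_const.mul
      ((continuousOn_fourier (fun τ hτ => hadm.integrable i τ hτ) (hadm.continuous_C i) k).mono
        hsub)) (hsum (|k| + 1) (by positivity)) fun i τ hτ => ?_
    exact norm_rate_term_le hp hν hs hsub hB i (by linarith) hτ
  exact (hc.continuousAt (Icc_mem_nhds hat (by linarith))).continuousWithinAt

/-- Normal convergence in L¹, taken on the degenerate time interval [t, t], permits exchanging the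
cumulant series with the expectation. -/
theorem integrable_and_integral_cumulantRate [Countable ι] (hp : M.IsTransitionDensity x₀ t₀ p)
    (hν : ∀ i, 0 ≤ ν i) (hs : ∀ i k, ‖s i k‖ ≤ |k| ^ ν i) (hadm : IsAdmissible t₀ p ν C) (k : ℝ)
    {t : ℝ} (ht : t₀ < t) :
    Integrable (fun x => ∑' i, s i k / Real.Gamma (ν i + 1) * C i x t) (M.law x₀ t₀ t) ∧
    ∫ x : ℝ, Complex.exp (Complex.I * k * x) * ∑' i, s i k / Real.Gamma (ν i + 1) * C i x t
      ∂(M.law x₀ t₀ t) = charRate p ν s C k t := by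
  obtain ⟨B, hB, hsum⟩ := hadm.normal t t ht
  have hint : ∀ i, Integrable (fun x => s i k / Real.Gamma (ν i + 1) * (C i x t : ℂ))
      (M.law x₀ t₀ t) := fun i => by
    rw [hp.integrable_law_iff ht]
    refine ((hadm.integrable i t ht).ofReal (𝕜 := ℂ)).const_mul
      (s i k / Real.Gamma (ν i + 1)) |>.congr (.of_forall fun x => ?_)
    simp [mul_assoc]
  have hnorm : ∀ i, ∫ x, ‖s i k / Real.Gamma (ν i + 1) * (C i x t : ℂ)‖ ∂(M.law x₀ t₀ t)
      ≤ (|k| + 1) ^ ν i / Real.Gamma (ν i + 1) * B i := fun i => by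
    have h2 : ∫ x, ‖(C i x t : ℂ)‖ ∂(M.law x₀ t₀ t) = ∫ x, |C i x t| * p x t := by
      have := hp.integral_law ht (fun x => ((‖(C i x t : ℂ)‖ : ℝ) : ℂ))
      simp_rw [← Complex.ofReal_mul] at this
      rw [integral_complex_ofReal, integral_complex_ofReal] at this
      simpa using Complex.ofReal_injective this
    simp_rw [norm_mul]
    rw [integral_const_mul, h2]
    have h1 := norm_div_Gamma_le hν hs i (show |k| ≤ |k| + 1 by linarith)
    exact mul_le_mul h1 (hB i t ⟨le_rfl, le_rfl⟩) (integral_nonneg fun x =>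
      mul_nonneg (abs_nonneg _) ((hp t ht).1 x)) ((norm_nonneg _).trans h1)
  have hsum' : Summable fun i => ∫ x, ‖s i k / Real.Gamma (ν i + 1) * (C i x t : ℂ)‖
      ∂(M.law x₀ t₀ t) :=
    .of_nonneg_of_le (fun i => integral_nonneg fun _ => norm_nonneg _) hnorm
      (hsum (|k| + 1) (by positivity))
  refine ⟨integrable_tsum_of_summable_integral_norm hint hsum', ?_⟩
  simp_rw [← tsum_mul_left]
  rw [← integral_tsum_of_summable_integral_norm
    (F := fun i (x : ℝ) => Complex.exp (Complex.I * k * x)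
      * (s i k / Real.Gamma (ν i + 1) * C i x t))
    (fun i => (hint i).bdd_mul (c := 1) (by fun_prop) (.of_forall fun x => by
      rw [norm_exp_I_mul_mul]))
    (by simpa only [norm_mul (Complex.exp _), norm_exp_I_mul_mul, one_mul])]
  refine tsum_congr fun i => ?_
  rw [hp.integral_law ht, fourier, ← integral_const_mul]
  congr 1 with x
  push_cast
  ring

theorem hasDerivWithinAt_fourier_density [Countable ι] (hp : M.IsTransitionDensity x₀ t₀ p)
    (hν : ∀ i, 0 ≤ ν i) (hs : ∀ i k, ‖s i k‖ ≤ |k| ^ ν i) (hadm : IsAdmissible t₀ p ν C)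
    (hK : M.HasCumulantExpansion x₀ t₀ K ν s C) (k : ℝ) {t : ℝ} (ht : t₀ < t) :
    HasDerivWithinAt (fun τ => fourier (fun x => (p x τ : ℂ)) k) (charRate p ν s C k t)
      (Ioi t) t := by
  obtain ⟨hint, heq⟩ := integrable_and_integral_cumulantRate hp hν hs hadm k ht
  have h := tendsto_integral_of_cumulant hint
    (fun δ hδ => (M.measurable_incrementCharFun k t hδ.le).aestronglyMeasurable)
    (fun δ x => M.norm_incrementCharFun_le k δ x t) (hK.exp_eq k t ht) (hK.remainder k t ht)
    (e := fun x : ℝ => Complex.exp (Complex.I * k * x)) (by fun_prop)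
    (fun x => norm_exp_I_mul_mul k x)
  rw [heq] at h
  rw [hasDerivWithinAt_iff_tendsto_slope' (by simp)]
  have hm : Tendsto (fun τ => τ - t) (𝓝[>] t) (𝓝[>] 0) := by
    refine tendsto_nhdsWithin_iff.2 ⟨?_, ?_⟩
    · refine (Continuous.tendsto' (by fun_prop) t 0 (by simp)).mono_left nhdsWithin_le_nhds
    · filter_upwards [self_mem_nhdsWithin] with τ hτ
      simpa using hτ
  refine (h.comp hm).congr' ?_
  filter_upwards [self_mem_nhdsWithin] with τ hτ
  have hτ : t < τ := hτ
  rw [slope_def_module, hp.fourier_eq ht, hp.fourier_eq (ht.trans hτ)]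
  have e := M.integral_exp_law_add k x₀ ht.le (sub_nonneg.2 hτ.le)
  rw [add_sub_cancel] at e
  rw [e, Function.comp_apply]
  congr 1
  simp_rw [mul_sub, mul_one]
  have hb : ∀ f : ℝ → ℂ, AEStronglyMeasurable f (M.law x₀ t₀ t) → (∀ x, ‖f x‖ ≤ 1) →
      Integrable f (M.law x₀ t₀ t) := fun f hf hf1 => .of_bound hf 1 (.of_forall hf1)
  refine integral_sub (hb _ ?_ fun x => ?_) (hb _ (by fun_prop) fun x => ?_)
  · exact AEStronglyMeasurable.mul (by fun_prop)
      (M.measurable_incrementCharFun k t (sub_nonneg.2 hτ.le)).aestronglyMeasurable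
  · rw [norm_mul, norm_exp_I_mul_mul, one_mul]
    exact M.norm_incrementCharFun_le _ _ _ _
  · rw [norm_exp_I_mul_mul]

theorem hasDerivAt_fourier_density [Countable ι] (hp : M.IsTransitionDensity x₀ t₀ p)
    (hν : ∀ i, 0 ≤ ν i) (hs : ∀ i k, ‖s i k‖ ≤ |k| ^ ν i) (hadm : IsAdmissible t₀ p ν C)
    (hK : M.HasCumulantExpansion x₀ t₀ K ν s C) (k : ℝ) {t : ℝ} (ht : t₀ < t) :
    HasDerivAt (fun τ => fourier (fun x => (p x τ : ℂ)) k) (charRate p ν s C k t) t :=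
  hasDerivAt_of_hasDerivWithinAt_Ioi
    (continuousOn_fourier (fun _ hτ => hp.integrable hτ) hadm.continuous_p k)
    (continuousOn_charRate hp hν hs hadm k)
    (fun _ hτ => hasDerivWithinAt_fourier_density hp hν hs hadm hK k hτ) ht

end Evolution

/-! ### Fourier analysis of Schwartz functions -/

open scoped FourierTransform

theorem fourier_eq_fourierTransform (f : ℝ → ℂ) (k : ℝ) :
    fourier f k = 𝓕 f (-(2 * Real.pi)⁻¹ * k) := by
  rw [fourier, Real.fourier_real_eq_integral_exp_smul]
  congr 1 with x
  rw [smul_eq_mul]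
  congr 2
  have : (Real.pi : ℂ) ≠ 0 := by exact_mod_cast Real.pi_ne_zero
  push_cast
  field_simp

theorem neg_inv_two_pi_ne_zero : -(2 * Real.pi)⁻¹ ≠ 0 := by
  simp [Real.pi_ne_zero]

theorem integrable_fourier (φ : 𝓢(ℝ, ℂ)) : Integrable (fourier φ) := by
  have h := ((𝓕 φ : 𝓢(ℝ, ℂ)).integrable (μ := volume)).comp_mul_left' neg_inv_two_pi_ne_zero
  refine h.congr (.of_forall fun k => ?_)
  simp only [fourier_eq_fourierTransform, SchwartzMap.fourier_coe]

theorem invFourier_fourier (φ : 𝓢(ℝ, ℂ)) (x : ℝ) : invFourier (fourier φ) x = φ x := by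
  have h := congrFun (φ.continuous.fourierInv_fourier_eq φ.integrable
    (by rw [← SchwartzMap.fourier_coe]; exact (𝓕 φ : 𝓢(ℝ, ℂ)).integrable)) x
  rw [← h, Real.fourierInv_eq', invFourier]
  have h2 := Measure.integral_comp_mul_left (fun v : ℝ =>
    Complex.exp (↑(2 * Real.pi * inner ℝ v x) * Complex.I) • 𝓕 (φ : ℝ → ℂ) v) (-(2 * Real.pi)⁻¹)
  have hπ : (Real.pi : ℂ) ≠ 0 := by exact_mod_cast Real.pi_ne_zero
  have e : ∀ k : ℝ, Complex.exp (-(Complex.I * k * x)) * fourier φ k =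
      Complex.exp (↑(2 * Real.pi * inner ℝ (-(2 * Real.pi)⁻¹ * k) x) * Complex.I)
        • 𝓕 (φ : ℝ → ℂ) (-(2 * Real.pi)⁻¹ * k) := fun k => by
    rw [fourier_eq_fourierTransform, smul_eq_mul]
    congr 2
    simp only [RCLike.inner_apply, conj_trivial]
    push_cast
    field_simp
  simp_rw [e]
  rw [h2, inv_neg, inv_inv, abs_neg, abs_of_pos Real.two_pi_pos, Complex.real_smul, ← mul_assoc]
  push_cast
  rw [one_div, inv_mul_cancel₀ (by simp [hπ]), one_mul]

/-- The iterated derivative of a Schwartz function, as a Schwartz function. -/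
def schwartzIteratedDeriv (n : ℕ) (φ : 𝓢(ℝ, ℂ)) : 𝓢(ℝ, ℂ) := (SchwartzMap.derivCLM ℂ ℂ)^[n] φ

theorem coe_schwartzIteratedDeriv (n : ℕ) (φ : 𝓢(ℝ, ℂ)) :
    ⇑(schwartzIteratedDeriv n φ) = iteratedDeriv n φ := by
  induction n with
  | zero => simp [schwartzIteratedDeriv]
  | succ n ih =>
    rw [iteratedDeriv_succ, ← ih]
    ext x
    rw [schwartzIteratedDeriv, Function.iterate_succ_apply', SchwartzMap.derivCLM_apply]
    rfl

/-- With the kernel e^{ikx} each integration by parts yields −ik, written i·(−k) to match the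
reflected symbols in `weak_kramersMoyal`. -/
theorem fourier_iteratedDeriv (n : ℕ) (φ : 𝓢(ℝ, ℂ)) (k : ℝ) :
    fourier (iteratedDeriv n φ) k = (Complex.I * ((-k : ℝ) : ℂ)) ^ n * fourier φ k := by
  rw [fourier_eq_fourierTransform, Real.fourier_iteratedDeriv (N := ⊤) (φ.smooth ⊤)
    (fun m _ => by rw [← coe_schwartzIteratedDeriv]; exact (schwartzIteratedDeriv m φ).integrable)
    le_top, fourier_eq_fourierTransform]
  beta_reduce
  rw [smul_eq_mul]
  congr 2
  have hπ : (Real.pi : ℂ) ≠ 0 := by exact_mod_cast Real.pi_ne_zero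
  push_cast
  field_simp

theorem invFourier_pow_mul_fourier (n : ℕ) (φ : 𝓢(ℝ, ℂ)) (x : ℝ) :
    invFourier (fun k => (Complex.I * ((-k : ℝ) : ℂ)) ^ n * fourier φ k) x
      = iteratedDeriv n φ x := by
  simp_rw [← fourier_iteratedDeriv]
  rw [← coe_schwartzIteratedDeriv]
  exact invFourier_fourier _ x

theorem integrable_rpow_mul_norm_fourier (φ : 𝓢(ℝ, ℂ)) {ν : ℝ} (hν : 0 ≤ ν) :
    Integrable fun k => |k| ^ ν * ‖fourier φ k‖ := by
  have h0 := (integrable_fourier φ).norm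
  -- This is the modulus of the transform of the derivative of order ⌈ν⌉; real powers follow from
  -- |k|^ν ≤ 1 + |k|^⌈ν⌉.
  have hn : Integrable fun k => |k| ^ ⌈ν⌉₊ * ‖fourier φ k‖ := by
    refine (integrable_fourier (schwartzIteratedDeriv ⌈ν⌉₊ φ)).norm.congr (.of_forall fun k => ?_)
    simp only [coe_schwartzIteratedDeriv, fourier_iteratedDeriv]
    simp
  refine (h0.add hn).mono' ?_ (.of_forall fun k => ?_)
  · exact AEStronglyMeasurable.mul
      (by have : Measurable fun k : ℝ => |k| ^ ν := by fun_prop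
          exact this.aestronglyMeasurable) h0.aestronglyMeasurable
  · rw [Real.norm_of_nonneg (by positivity), Pi.add_apply]
    have : |k| ^ ν ≤ 1 + |k| ^ ⌈ν⌉₊ := by
      rcases le_total |k| 1 with h | h
      · exact (Real.rpow_le_one (abs_nonneg k) h hν).trans (by simp)
      · have := Real.rpow_le_rpow_of_exponent_le h (Nat.le_ceil ν)
        rw [Real.rpow_natCast] at this
        linarith
    nlinarith [norm_nonneg (fourier φ k)]

/-- Parseval's formula. -/
theorem integral_invFourier_mul {w f : ℝ → ℂ} (hw : Integrable w) (hf : Integrable f) :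
    ∫ x, invFourier w x * f x = 1 / (2 * Real.pi) * ∫ k, w k * fourier f (-k) := by
  have hprod : Integrable (Function.uncurry fun x k : ℝ =>
      Complex.exp (-(Complex.I * k * x)) * w k * f x) (volume.prod volume) := by
    have h := (hf.mul_prod hw).bdd_mul (c := 1)
      (f := fun z : ℝ × ℝ => Complex.exp (-(Complex.I * z.2 * z.1))) (by fun_prop)
      (.of_forall fun z => by
        have := norm_exp_I_mul_mul (-z.2) z.1
        rw [← this]
        apply le_of_eq
        push_cast
        ring_nf)
    refine h.congr (.of_forall fun z => ?_)
    simp only [Function.uncurry]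
    ring
  have h := integral_integral_swap hprod
  have e : ∀ x, invFourier w x * f x
      = 1 / (2 * Real.pi) * ∫ k : ℝ, Complex.exp (-(Complex.I * k * x)) * w k * f x := fun x => by
    rw [invFourier, mul_assoc, integral_mul_const]
  simp_rw [e]
  rw [integral_const_mul, h]
  congr 2 with k
  rw [fourier, ← integral_const_mul]
  congr 1 with x
  push_cast
  ring_nf

/-- For a test function, the normal convergence of the cumulant series passes to the weighted
integrals of the Fourier transform. -/
theorem summable_integral_rpow_mul_norm_fourier {ι : Type} {ν B : ι → ℝ} (hν : ∀ i, 0 ≤ ν i)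
    (hB : ∀ i, 0 ≤ B i)
    (hsum : ∀ R : ℝ, 0 < R → Summable fun i => R ^ ν i / Real.Gamma (ν i + 1) * B i)
    {φ : 𝓢(ℝ, ℂ)} (hφ : Finite ι ∨ HasCompactSupport (fourier φ)) :
    Summable fun i => ∫ k, |k| ^ ν i / Real.Gamma (ν i + 1) * B i * ‖fourier φ k‖ := by
  rcases hφ with hι | hφ
  · exact Summable.of_finite
  · obtain ⟨R, hR, hsupp⟩ := hφ.isCompact.isBounded.exists_pos_norm_le
    have hΓ : ∀ i, 0 < Real.Gamma (ν i + 1) := fun i =>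
      Real.Gamma_pos_of_pos (by linarith [hν i])
    refine .of_nonneg_of_le (fun i => integral_nonneg fun k => ?_) (fun i => ?_)
      ((hsum R hR).mul_right (∫ k, ‖fourier φ k‖))
    · have := hB i
      have := hΓ i
      positivity
    · rw [← integral_const_mul]
      refine integral_mono ?_ ((integrable_fourier φ).norm.const_mul _) fun k => ?_
      · refine ((integrable_rpow_mul_norm_fourier φ (hν i)).const_mul
          (B i / Real.Gamma (ν i + 1))).congr (.of_forall fun k => ?_)
        simp only
        ring
      · by_cases hk : fourier φ k = 0
        · simp [hk]
        · have hkR : |k| ≤ R := hsupp k (subset_tsupport _ hk)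
          have := hB i
          have := hΓ i
          have := hν i
          simp only
          gcongr

/-! ### The weak equation -/

section Evolution

variable {Ω : Type*} [MeasurableSpace Ω] {M : MarkovProcess Ω} {x₀ t₀ : ℝ} {p : ℝ → ℝ → ℝ}
  {K : ℝ → ℝ → ℝ → ℝ → ℂ} {ι : Type} [Countable ι] {ν : ι → ℝ} {s : ι → ℝ → ℂ}
  {C : ι → ℝ → ℝ → ℝ}

/-- The Kramers–Moyal expansion in weak form. -/
theorem weak_kramersMoyal (hp : M.IsTransitionDensity x₀ t₀ p)
    (hν : ∀ i, 0 ≤ ν i) (hs : ∀ i k, ‖s i k‖ ≤ |k| ^ ν i) (hsm : ∀ i, Measurable (s i))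
    (hadm : IsAdmissible t₀ p ν C) (hK : M.HasCumulantExpansion x₀ t₀ K ν s C) {t : ℝ}
    (ht : t₀ < t) {φ : 𝓢(ℝ, ℂ)} (hφ : Finite ι ∨ HasCompactSupport (fourier φ)) :
    (Summable fun i => ∫ x, invFourier (fun k => s i (-k) * fourier φ k) x / Real.Gamma (ν i + 1)
      * ((C i x t * p x t : ℝ) : ℂ)) ∧
    HasDerivAt (fun τ => ∫ x, φ x * (p x τ : ℂ))
      (∑' i, ∫ x, invFourier (fun k => s i (-k) * fourier φ k) x / Real.Gamma (ν i + 1)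
        * ((C i x t * p x t : ℝ) : ℂ)) t := by
  obtain ⟨a, ha, hat⟩ := exists_between ht
  obtain ⟨B, hB, hsum⟩ := hadm.normal a (t + 1) ha
  have hsub : Icc a (t + 1) ⊆ Ioi t₀ := fun x hx => ha.trans_le hx.1
  have htI : t ∈ Icc a (t + 1) := ⟨hat.le, by linarith⟩
  have hB0 : ∀ i, 0 ≤ B i := fun i => le_trans (integral_nonneg fun x =>
    mul_nonneg (abs_nonneg _) ((hp t ht).1 x)) (hB i t htI)
  have hΓ : ∀ i, 0 < Real.Gamma (ν i + 1) := fun i =>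
    Real.Gamma_pos_of_pos (by linarith [hν i])
  have hflux : ∀ i, Integrable fun x => ((C i x t * p x t : ℝ) : ℂ) := fun i =>
    (hadm.integrable i t ht).ofReal
  have hφi := integrable_fourier φ
  have h2π : ‖(1 / (2 * Real.pi) : ℂ)‖ ≤ 1 := by
    have : (1 / (2 * Real.pi) : ℂ) = ((1 / (2 * Real.pi) : ℝ) : ℂ) := by push_cast; rfl
    rw [this, Complex.norm_real, Real.norm_of_nonneg (by positivity),
      div_le_one (by positivity)]
    linarith [Real.pi_gt_three]
  -- These majorants are independent of time on [a, t + 1]; their sum dominates the differentiated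
  -- integrand.
  set b : ι → ℝ → ℝ := fun i k => |k| ^ ν i / Real.Gamma (ν i + 1) * B i * ‖fourier φ k‖ with hb
  have hb0 : ∀ i k, 0 ≤ b i k := fun i k => by
    have := hB0 i
    have := hΓ i
    positivity
  have hbi : ∀ i, Integrable (b i) := fun i => by
    refine ((integrable_rpow_mul_norm_fourier φ (hν i)).const_mul
      (B i / Real.Gamma (ν i + 1))).congr (.of_forall fun k => ?_)
    simp only [hb]
    ring
  have hbs : Summable fun i => ∫ k, b i k :=
    summable_integral_rpow_mul_norm_fourier hν hB0 hsum hφ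
  have hbsk : ∀ k, Summable fun i => b i k := fun k => by
    refine Summable.mul_right _ (.of_nonneg_of_le (fun i => ?_) (fun i => ?_)
      (hsum (|k| + 1) (by positivity)))
    · have := hB0 i
      have := hΓ i
      positivity
    · have := hB0 i
      have := hΓ i
      have := hν i
      gcongr
      linarith
  have hbt : Integrable fun k => ∑' i, b i k :=
    integrable_tsum_of_summable_integral_norm hbi (by
      simpa only [Real.norm_of_nonneg (hb0 _ _)] using hbs)
  -- The i-th flux term on the Fourier side. Parseval's formula pairs k with −k, hence the reflected
  -- frequency.
  let G : ι → ℝ → ℝ → ℂ := fun i τ k => 1 / (2 * Real.pi) * (fourier φ k *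
    (s i (-k) / Real.Gamma (ν i + 1) * fourier (fun x => ((C i x τ * p x τ : ℝ) : ℂ)) (-k)))
  have hGb : ∀ i, ∀ τ ∈ Icc a (t + 1), ∀ k, ‖G i τ k‖ ≤ b i k := fun i τ hτ k => by
    simp only [G, hb]
    rw [norm_mul, norm_mul (fourier φ k), mul_comm ‖fourier φ k‖]
    refine (mul_le_of_le_one_left (by positivity) h2π).trans ?_
    gcongr
    exact norm_rate_term_le hp hν hs hsub hB i (by rw [abs_neg]) hτ
  have hGm : ∀ i, Measurable (G i t) := fun i => by
    refine measurable_const.mul ((continuous_fourier φ.integrable).measurable.mul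
      ((((hsm i).comp measurable_neg).div_const _).mul ?_))
    exact ((continuous_fourier (hflux i)).comp continuous_neg).measurable
  have hGi : ∀ i, Integrable (G i t) := fun i =>
    (hbi i).mono' (hGm i).aestronglyMeasurable (.of_forall (hGb i t htI))
  have hGs : Summable fun i => ∫ k, ‖G i t k‖ :=
    .of_nonneg_of_le (fun i => by positivity)
      (fun i => integral_mono (hGi i).norm (hbi i) (hGb i t htI)) hbs
  have hGint : ∀ i, ∫ k, G i t k = ∫ x, invFourier (fun k => s i (-k) * fourier φ k) x
      / Real.Gamma (ν i + 1) * ((C i x t * p x t : ℝ) : ℂ) := fun i => by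
    have hw : Integrable fun k => s i (-k) * fourier φ k := by
      refine (integrable_rpow_mul_norm_fourier φ (hν i)).mono'
        (((hsm i).comp measurable_neg).aestronglyMeasurable.mul hφi.aestronglyMeasurable)
        (.of_forall fun k => ?_)
      rw [norm_mul]
      gcongr
      simpa using hs i (-k)
    have hP := integral_invFourier_mul hw (hflux i)
    have e : ∀ x, invFourier (fun k => s i (-k) * fourier φ k) x
      / Real.Gamma (ν i + 1) * ((C i x t * p x t : ℝ) : ℂ) = (Real.Gamma (ν i + 1) : ℂ)⁻¹ *
      (invFourier (fun k => s i (-k) * fourier φ k) x * ((C i x t * p x t : ℝ) : ℂ)) :=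
      fun x => by ring
    symm
    simp_rw [e]
    rw [integral_const_mul, hP, ← integral_const_mul, ← integral_const_mul]
    congr 1 with k
    simp only [G]
    ring
  have hsumG := hasSum_integral_of_summable_integral_norm hGi hGs
  simp_rw [hGint] at hsumG
  refine ⟨hsumG.summable, ?_⟩
  rw [hsumG.tsum_eq]
  -- The Parseval integrand of ∫ φ p; by `hGF` and the evolution of the characteristic function, its
  -- time derivative is the sum of the `G i`.
  let F : ℝ → ℝ → ℂ := fun τ k => 1 / (2 * Real.pi) * (fourier φ k *
    fourier (fun x => (p x τ : ℂ)) (-k))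
  have hGF : ∀ τ k, ∑' i, G i τ k = 1 / (2 * Real.pi) * (fourier φ k *
      charRate p ν s C (-k) τ) := fun τ k => by
    simp only [G, charRate, tsum_mul_left]
  have hFm : ∀ τ, t₀ < τ → AEStronglyMeasurable (F τ) := fun τ hτ => by
    refine Continuous.aestronglyMeasurable (continuous_const.mul
      ((continuous_fourier φ.integrable).mul ?_))
    exact (continuous_fourier (hp.integrable hτ).ofReal).comp continuous_neg
  have hFi : Integrable (F t) := by
    refine (hφi.norm.const_mul (∫ x, ‖(p x t : ℂ)‖)).mono' (hFm t ht) (.of_forall fun k => ?_)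
    simp only [F]
    rw [norm_mul, norm_mul, mul_comm ‖fourier φ k‖]
    refine (mul_le_of_le_one_left (by positivity) h2π).trans ?_
    gcongr
    exact norm_fourier_le _ _
  have hder := hasDerivAt_integral_of_dominated_loc_of_deriv_le (μ := volume) (𝕜 := ℝ) (F := F)
    (F' := fun τ k => ∑' i, G i τ k) (x₀ := t) (s := Icc a (t + 1))
    (bound := fun k => ∑' i, b i k) (Icc_mem_nhds hat (by linarith))
    (by filter_upwards [Ioi_mem_nhds ht] with τ hτ using hFm τ hτ) hFi
    (Measurable.tsum hGm).aestronglyMeasurable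
    (.of_forall fun k τ hτ => tsum_of_norm_bounded (hbsk k).hasSum fun i => hGb i τ hτ k) hbt
    (.of_forall fun k τ hτ => by
      rw [hGF]
      exact ((hasDerivAt_fourier_density hp hν hs hadm hK (-k) (hsub hτ)).const_mul _).const_mul _)
  refine hder.2.congr_of_eventuallyEq ?_
  filter_upwards [Ioi_mem_nhds ht] with τ hτ
  have hpi : Integrable fun x => (p x τ : ℂ) := (hp.integrable hτ).ofReal
  simp only [F]
  rw [integral_const_mul, ← integral_invFourier_mul hφi hpi]
  simp_rw [invFourier_fourier]

end Evolution

/-! ### Fractional symbols; from weak to classical solutions -/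

open scoped ContDiff

theorem norm_fracPow (θ n k : ℝ) : ‖fracPow θ n k‖ = |k| ^ n := by
  have e : Complex.I * (θ : ℂ) * ((SignType.sign k : SignType) : ℂ)
      = ((θ * ((SignType.sign k : SignType) : ℝ) : ℝ) : ℂ) * Complex.I := by
    rcases lt_trichotomy k 0 with h | h | h
    · simp [sign_neg h, mul_comm]
    · simp [h]
    · simp [sign_pos h, mul_comm]
  rw [fracPow, norm_mul, e, Complex.norm_exp_ofReal_mul_I, mul_one, Complex.norm_real,
    Real.norm_of_nonneg (by positivity)]

theorem measurable_fracPow (θ n : ℝ) : Measurable (fracPow θ n) := by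
  have hs : Measurable fun k : ℝ => ((SignType.sign k : SignType) : ℂ) := by
    have e : (fun k : ℝ => ((SignType.sign k : SignType) : ℂ))
        = fun k => if 0 < k then 1 else if k < 0 then -1 else 0 := by
      ext k
      rw [sign_apply]
      split_ifs <;> simp
    rw [e]
    exact measurable_const.ite measurableSet_Ioi
      (measurable_const.ite measurableSet_Iio measurable_const)
  unfold fracPow
  exact (Complex.measurable_ofReal.comp (by fun_prop)).mul
    (Complex.measurable_exp.comp (measurable_const.mul hs))

theorem fracDerivTranspose_eq (θ n : ℝ) (φ : ℝ → ℂ) (x : ℝ) :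
    fracDerivTranspose θ n φ x
      = invFourier (fun k => fracPow θ n (-k) * fourier φ k) x / (-1 : ℂ) ^ (n : ℂ) := by
  simp only [fracDerivTranspose, fourierMultiplier, fracDerivSymbol, invFourier]
  rw [mul_div_assoc, ← integral_div]
  congr 2 with k
  ring

theorem neg_one_cpow_ne_zero (n : ℂ) : (-1 : ℂ) ^ n ≠ 0 := by
  simp [Complex.cpow_eq_zero_iff]

/-- Integration by parts against a smooth compactly supported function. -/
theorem integral_iteratedDeriv_mul {n : ℕ} {g h : ℝ → ℝ} (hg : ContDiff ℝ ∞ g)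
    (hgc : HasCompactSupport g) (hh : ContDiff ℝ n h) :
    ∫ x, iteratedDeriv n g x * h x = (-1) ^ n * ∫ x, g x * iteratedDeriv n h x := by
  induction n generalizing g with
  | zero => simp
  | succ n ih =>
    have hg' : ContDiff ℝ ∞ (deriv g) := (contDiff_infty_iff_deriv.1 hg).2
    have hh' : ContDiff ℝ 1 (iteratedDeriv n h) :=
      contDiff_nat_succ_iff_contDiff_one_iteratedDeriv.1 (by exact_mod_cast hh) |>.2
    have hd : Continuous (deriv (iteratedDeriv n h)) := hh'.continuous_deriv le_rfl
    rw [iteratedDeriv_succ', ih hg' hgc.deriv (hh.of_le (by exact_mod_cast n.le_succ)),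
      iteratedDeriv_succ, integral_mul_deriv_eq_deriv_mul_of_integrable (u' := deriv g)
        (v := iteratedDeriv n h)
        (fun x _ => (hg.differentiable (by simp) x).hasDerivAt)
        (fun x _ => (hh'.differentiable (by simp) x).hasDerivAt)]
    · ring
    · exact (hg.continuous.mul hd).integrable_of_hasCompactSupport hgc.mul_right
    · exact (hg'.continuous.mul hh'.continuous).integrable_of_hasCompactSupport hgc.deriv.mul_right
    · exact (hg.continuous.mul hh'.continuous).integrable_of_hasCompactSupport hgc.mul_right

theorem iteratedDeriv_ofReal_comp {n : ℕ} {g : ℝ → ℝ} (hg : ContDiff ℝ ∞ g) (x : ℝ) :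
    iteratedDeriv n (fun y => (g y : ℂ)) x = ((iteratedDeriv n g x : ℝ) : ℂ) := by
  induction n generalizing x with
  | zero => simp
  | succ n ih =>
    rw [iteratedDeriv_succ, iteratedDeriv_succ, funext ih]
    exact ((hg.differentiable_iteratedDeriv n (by exact_mod_cast ENat.natCast_lt_top n)
      x).hasDerivAt.ofReal_comp).deriv

/-- Differentiation of the pairing of a density with a compactly supported function. -/
theorem hasDerivAt_integral_mul {p : ℝ → ℝ → ℝ} {t₀ t : ℝ} (ht : t₀ < t)
    (hp : ∀ τ, t₀ < τ → Integrable fun x => p x τ)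
    (hd : ∀ x τ, t₀ < τ → DifferentiableAt ℝ (fun σ => p x σ) τ)
    (hc : ContinuousOn (fun z : ℝ × ℝ => deriv (fun τ => p z.1 τ) z.2) (univ ×ˢ Ioi t₀))
    {g : ℝ → ℝ} (hg : Continuous g) (hgc : HasCompactSupport g) :
    HasDerivAt (fun τ => ∫ x, g x * p x τ) (∫ x, g x * deriv (fun τ => p x τ) t) t := by
  obtain ⟨a, ha, hat⟩ := exists_between ht
  have hsub : Icc a (t + 1) ⊆ Ioi t₀ := fun x hx => ha.trans_le hx.1
  -- A bound for ∂p/∂t is needed only over the support of `g`, since the integrand vanishes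
  -- elsewhere.
  obtain ⟨D, hD⟩ := (hgc.isCompact.prod
    (isCompact_Icc (a := a) (b := t + 1))).exists_bound_of_continuousOn
    (hc.mono (prod_mono (subset_univ _) hsub))
  have hct : Continuous fun x => deriv (fun τ => p x τ) t := by
    rw [← continuousOn_univ]
    exact hc.comp (f := fun x : ℝ => (x, t)) (by fun_prop) fun x _ => ⟨mem_univ _, ht⟩
  refine (hasDerivAt_integral_of_dominated_loc_of_deriv_le (s := Icc a (t + 1))
    (bound := fun x => D * ‖g x‖) (F' := fun τ x => g x * deriv (fun σ => p x σ) τ)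
    (Icc_mem_nhds hat (by linarith)) ?_ ?_ (hg.mul hct).aestronglyMeasurable
    (.of_forall fun x τ hτ => ?_) ((hg.integrable_of_hasCompactSupport hgc).norm.const_mul D)
    (.of_forall fun x τ hτ => ((hd x τ (hsub hτ)).hasDerivAt.const_mul _))).2
  · filter_upwards [Ioi_mem_nhds ht] with τ hτ
    exact hg.aestronglyMeasurable.mul (hp τ hτ).aestronglyMeasurable
  · obtain ⟨c, hc⟩ := hgc.exists_bound_of_continuous hg
    exact (hp t ht).bdd_mul hg.aestronglyMeasurable (.of_forall hc)
  · by_cases hx : x ∈ tsupport g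
    · rw [norm_mul, mul_comm]
      gcongr
      exact hD (x, τ) ⟨hx, hτ⟩
    · simp [image_eq_zero_of_notMem_tsupport hx]

/-- A weak solution of finite order which is regular enough is a classical solution. -/
theorem IsWeakSolution.hasDerivAt {p : ℝ → ℝ → ℝ} {t₀ : ℝ} {J : Set ℕ} {A : ℕ → ℝ → ℝ → ℝ}
    (h : IsWeakSolution t₀ J A p) (hJ : J.Finite) (hcl : IsClassical t₀ J A p)
    (hp : ∀ τ, t₀ < τ → Integrable fun x => p x τ) (x : ℝ) {t : ℝ} (ht : t₀ < t) :
    HasDerivAt (fun τ => p x τ) (∑' n : J, iteratedDeriv n (fun y => A n y t * p y t) x) t := by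
  obtain ⟨hd, hc, hA⟩ := hcl
  have := hJ.fintype
  have hct : Continuous fun x => deriv (fun τ => p x τ) t := by
    rw [← continuousOn_univ]
    exact hc.comp (f := fun x : ℝ => (x, t)) (by fun_prop) fun x _ => ⟨mem_univ _, ht⟩
  have hcn : ∀ n : J, Continuous (iteratedDeriv n fun y => A n y t * p y t) := fun n =>
    (hA n n.2 t ht).continuous_iteratedDeriv n le_rfl
  have hcs : Continuous fun x => ∑ n : J, iteratedDeriv n (fun y => A n y t * p y t) x :=
    continuous_finsetSum _ fun n _ => hcn n
  have hae := ae_eq_of_integral_contDiff_smul_eq (μ := volume) hct.locallyIntegrable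
    hcs.locallyIntegrable fun g hg hgc => by
      have hφ : HasCompactSupport fun x => (g x : ℂ) := hgc.comp_left (g := Complex.ofReal) rfl
      -- Finiteness of `J` is essential here: a nonzero compactly supported `g` has no compactly
      -- supported Fourier transform.
      have hw := ((h t ht).2 (hφ.toSchwartzMap (Complex.ofRealCLM.contDiff.comp hg)) (.inl hJ)).2
      have hr : HasDerivAt (fun τ => ((∫ x, g x * p x τ : ℝ) : ℂ))
          ((∫ x, g x * deriv (fun τ => p x τ) t : ℝ) : ℂ) t :=
        (hasDerivAt_integral_mul ht hp hd hc hg.continuous hgc).ofReal_comp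
      have e1 : (fun τ => ∫ x, (hφ.toSchwartzMap (Complex.ofRealCLM.contDiff.comp hg)) x
          * (p x τ : ℂ)) = fun τ => ((∫ x, g x * p x τ : ℝ) : ℂ) := by
        ext τ
        rw [← integral_complex_ofReal]
        congr 1 with x
        push_cast
        rfl
      rw [e1] at hw
      have hu := hr.unique hw
      simp only [smul_eq_mul, Finset.mul_sum]
      have hgi : ∀ n : J, Integrable fun x =>
          g x * iteratedDeriv n (fun y => A n y t * p y t) x := fun n =>
        (hg.continuous.mul (hcn n)).integrable_of_hasCompactSupport hgc.mul_right
      rw [integral_finsetSum _ fun n _ => hgi n]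
      apply Complex.ofReal_injective
      rw [hu, tsum_fintype, Complex.ofReal_sum]
      refine Finset.sum_congr rfl fun n _ => ?_
      have hibp := integral_iteratedDeriv_mul hg hgc (hA n n.2 t ht)
      have e2 : ∀ x, (-1) ^ (n : ℕ) * iteratedDeriv n
          (hφ.toSchwartzMap (Complex.ofRealCLM.contDiff.comp hg)) x
          * ((A n x t * p x t : ℝ) : ℂ)
          = (((-1) ^ (n : ℕ) * (iteratedDeriv n g x * (A n x t * p x t)) : ℝ) : ℂ) := fun x => by
        have : iteratedDeriv n (hφ.toSchwartzMap (Complex.ofRealCLM.contDiff.comp hg)) x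
            = ((iteratedDeriv n g x : ℝ) : ℂ) := iteratedDeriv_ofReal_comp hg x
        rw [this]
        push_cast
        ring
      simp_rw [e2]
      rw [integral_complex_ofReal, integral_const_mul, hibp, ← mul_assoc, ← mul_pow]
      simp
  -- Continuous functions that agree almost everywhere agree everywhere.
  have heq := congrFun ((hct.ae_eq_iff_eq volume hcs).1 hae) x
  rw [tsum_fintype]
  rw [← heq]
  exact (hd x t ht).hasDerivAt

/-! ### Integer and real orders -/

section Solutions

variable {Ω : Type*} [MeasurableSpace Ω] {M : MarkovProcess Ω} {x₀ t₀ : ℝ} {p : ℝ → ℝ → ℝ}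
  {K : ℝ → ℝ → ℝ → ℝ → ℂ}

theorem isWeakSolution (hp : M.IsTransitionDensity x₀ t₀ p) {J : Set ℕ} {C A : ℕ → ℝ → ℝ → ℝ}
    (hK : M.HasCumulantExpansion x₀ t₀ K (fun n : J => ((n : ℕ) : ℝ))
      (fun n k => (Complex.I * k) ^ (n : ℕ)) (fun n => C n))
    (hadm : IsAdmissible t₀ p (fun n : J => ((n : ℕ) : ℝ)) (fun n => C n))
    (hA : ∀ n ∈ J, ∀ x t, A n x t = (-1) ^ n / (Nat.factorial n) * C n x t) :
    IsWeakSolution t₀ J A p := by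
  refine fun t ht => ⟨fun n hn => ?_, fun φ hφ => ?_⟩
  · refine ((hadm.integrable ⟨n, hn⟩ t ht).const_mul ((-1) ^ n / (Nat.factorial n))).congr
      (.of_forall fun x => ?_)
    simp only [hA n hn]
    ring
  · have h := weak_kramersMoyal (ν := fun n : J => ((n : ℕ) : ℝ))
      (s := fun n k => (Complex.I * k) ^ (n : ℕ)) (C := fun n => C n) hp
      (fun n => Nat.cast_nonneg _)
      (fun n k => by simp) (fun n => by fun_prop) hadm hK ht (φ := φ)
      (hφ.imp (fun hJ => hJ.to_subtype) id)
    have e : ∀ n : J, ∫ x, invFourier (fun k : ℝ => (Complex.I * ((-k : ℝ) : ℂ)) ^ (n : ℕ)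
          * fourier φ k) x / Real.Gamma (((n : ℕ) : ℝ) + 1) * ((C n x t * p x t : ℝ) : ℂ)
        = ∫ x, (-1) ^ (n : ℕ) * iteratedDeriv n φ x * ((A n x t * p x t : ℝ) : ℂ) := fun n => by
      congr 1 with x
      rw [invFourier_pow_mul_fourier, Real.Gamma_nat_eq_factorial, hA n n.2]
      -- The sign in `A` and the sign from transposing the derivative cancel.
      have h1 : ((-1 : ℂ) ^ (n : ℕ)) * (-1) ^ (n : ℕ) = 1 := by
        rw [← mul_pow]
        simp
      push_cast
      linear_combination (-(iteratedDeriv n φ x / (Nat.factorial n) * (C n x t * p x t))) * h1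
    simp_rw [e] at h
    exact h

theorem isFracWeakSolution (hp : M.IsTransitionDensity x₀ t₀ p) {J : Set ℝ} {θ : ℝ → ℝ}
    {C : ℝ → ℝ → ℝ → ℝ} {A : ℝ → ℝ → ℝ → ℂ} (hJ : J.Countable) (hJ0 : ∀ n ∈ J, 0 ≤ n)
    (hK : M.HasCumulantExpansion x₀ t₀ K (fun n : J => (n : ℝ))
      (fun n k => fracPow (θ n) n k) (fun n => C n))
    (hadm : IsAdmissible t₀ p (fun n : J => (n : ℝ)) (fun n => C n))
    (hA : ∀ n ∈ J, ∀ x t, A n x t = (-1 : ℂ) ^ (n : ℂ) / Real.Gamma (n + 1) * C n x t) :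
    IsFracWeakSolution t₀ J θ A p := by
  have := hJ.to_subtype
  refine fun t ht => ⟨fun n hn => ?_, fun φ hφ => ?_⟩
  · refine ((hadm.integrable ⟨n, hn⟩ t ht).ofReal (𝕜 := ℂ)).const_mul
      ((-1 : ℂ) ^ (n : ℂ) / Real.Gamma (n + 1)) |>.congr (.of_forall fun x => ?_)
    simp only [hA n hn]
    push_cast
    simp [mul_assoc]
  · have h := weak_kramersMoyal (ν := fun n : J => (n : ℝ))
      (s := fun n k => fracPow (θ n) n k) (C := fun n => C n) hp (fun n => hJ0 n n.2)
      (fun n k => (norm_fracPow _ _ _).le) (fun n => measurable_fracPow _ _) hadm hK ht (φ := φ)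
      (hφ.imp (fun hJ => hJ.to_subtype) id)
    have e : ∀ n : J, ∫ x, invFourier (fun k : ℝ => fracPow (θ n) n (-k) * fourier φ k) x
          / Real.Gamma ((n : ℝ) + 1) * ((C n x t * p x t : ℝ) : ℂ)
        = ∫ x, fracDerivTranspose (θ n) n φ x * (A n x t * (p x t : ℂ)) := fun n => by
      congr 1 with x
      rw [fracDerivTranspose_eq, hA n n.2]
      -- The factor (−1)ⁿ in `A` cancels the denominator of `fracDerivSymbol`; only its being
      -- nonzero matters, not its branch.
      have h1 := neg_one_cpow_ne_zero ((n : ℝ) : ℂ)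
      rw [Complex.ofReal_mul]
      generalize invFourier _ x = u
      generalize (-1 : ℂ) ^ ((n : ℝ) : ℂ) = v at h1
      field_simp
    simp_rw [e] at h
    exact h

end Solutions

end KramersMoyal

end

theorem proposition3 {Ω : Type*} [MeasurableSpace Ω] (M : KramersMoyal.MarkovProcess Ω)
    (x₀ t₀ : ℝ) (p : ℝ → ℝ → ℝ) (hp : M.IsTransitionDensity x₀ t₀ p)
    (K : ℝ → ℝ → ℝ → ℝ → ℂ) :
    -- integer orders
    (∀ (J : Set ℕ) (C A : ℕ → ℝ → ℝ → ℝ),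
      M.HasCumulantExpansion x₀ t₀ K (fun n : J => ((n : ℕ) : ℝ))
        (fun n k => (Complex.I * k) ^ (n : ℕ)) (fun n => C n) →
      KramersMoyal.IsAdmissible t₀ p (fun n : J => ((n : ℕ) : ℝ)) (fun n => C n) →
      (∀ n ∈ J, ∀ x t, A n x t = (-1) ^ n / (Nat.factorial n) * C n x t) →
        KramersMoyal.IsWeakSolution t₀ J A p ∧
        (J.Finite → KramersMoyal.IsClassical t₀ J A p →
          ∀ x t, t₀ < t → HasDerivAt (fun τ => p x τ)
            (∑' n : J, iteratedDeriv n (fun y => A n y t * p y t) x) t)) ∧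
    -- real orders
    (∀ (J : Set ℝ) (θ : ℝ → ℝ) (C : ℝ → ℝ → ℝ → ℝ) (A : ℝ → ℝ → ℝ → ℂ),
      J.Countable → (∀ n ∈ J, 0 ≤ n) →
      M.HasCumulantExpansion x₀ t₀ K (fun n : J => (n : ℝ))
        (fun n k => KramersMoyal.fracPow (θ n) n k) (fun n => C n) →
      KramersMoyal.IsAdmissible t₀ p (fun n : J => (n : ℝ)) (fun n => C n) →
      (∀ n ∈ J, ∀ x t, A n x t = (-1 : ℂ) ^ (n : ℂ) / Real.Gamma (n + 1) * C n x t) →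
        KramersMoyal.IsFracWeakSolution t₀ J θ A p) := by
  refine ⟨fun J C A hK hadm hA => ?_, fun J θ C A hJ hJ0 hK hadm hA =>
    KramersMoyal.isFracWeakSolution hp hJ hJ0 hK hadm hA⟩
  have h := KramersMoyal.isWeakSolution hp hK hadm hA
  exact ⟨h, fun hJ hcl x t ht => h.hasDerivAt hJ hcl (fun τ hτ => hp.integrable hτ) x ht⟩
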